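/- Let $\mathbb{D}$ be the open unit disc and $\mathbb{T}$ the unit circle in $\mathbb{C}$, $m$ the normalized Lebesgue measure on $\mathbb{T}$, and $A$ the area measure on $\mathbb{D}$ normalized by $A(\mathbb{D})=1$. Let $H^2$ be the Hardy space of holomorphic functions $f$ on $\mathbb{D}$ with $\sup_{0\le r<1}\int_{\mathbb{T}}|f(r\tau)|^2\,dm(\tau)<\infty$, with the scalar product $\langle f,g\rangle=\lim_{r\to1^-}\int_{\mathbb{T}}f(r\tau)\overline{g(r\tau)}\,dm(\tau)$. Let $\Theta$ be an inner function, i.e. a bounded holomorphic function on $\mathbb{D}$ whose radial boundary values satisfy $|\Theta(\tau)|=1$ for a.e. $\tau\in\mathbb{T}$, and let $K_\Theta=H^2\ominus\Theta H^2$ be the orthogonal complement of $\Theta H^2$ in $H^2$. For $f$ holomorphic on $\mathbb{D}$, $\alpha>-1$ and $1<p<\infty$ define the following quantities in $[0,\infty]$: $$\|f\|_{A_p(\alpha)}=\Big(\int_{\mathbb{D}}(1-|u|^2)^{\alpha}|f(u)|^p\,dA(u)\Big)^{1/p},$$ $$\|f\|_{BMOA}=\inf\Big\{\|g\|_{L^\infty(\mathbb{T})}:\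 g\in L^\infty(\mathbb{T}),\ f(\xi)=\frac1{2\pi i}\int_{\mathbb{T}}\frac{g(u)}{u-\xi}\,du\ \text{ for all }\xi\in\mathbb{D}\Big\}$$ (with $\inf\emptyset=\infty$), and $$I_{p,\alpha}(\Theta)=\int_{\mathbb{D}}(1-|u|^2)^{\alpha}\Big(\frac{1-|\Theta(u)|^2}{1-|u|^2}\Big)^p\,dA(u).$$ **Proposition.** Let $\alpha>-1$, $1<p<\infty$, let $\Theta$ be an inner function and let $f\in K_\Theta$. Then, in $[0,\infty]$ and with the convention $0\cdot\infty=0$, $$\|f'\|_{A_p(\alpha)}\le\|f\|_{BMOA}\,\big(I_{p,\alpha}(\Theta)\big)^{1/p}.$$ -/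

import Mathlib

open MeasureTheory Filter Topology Metric
open scoped ENNReal ComplexConjugate

/-! Functions on the open unit disc are represented by functions `ℂ → ℂ` of which only the values
on `ball 0 1` are used. -/

/-- `f` belongs to the Hardy space `H²` of the unit disc: it is holomorphic in the disc and its
quadratic integral means over the circles of radius `r < 1` are bounded. -/
def IsHardyTwo (f : ℂ → ℂ) : Prop :=
  DifferentiableOn ℂ f (ball 0 1) ∧
    ∃ C : ℝ, ∀ r : ℝ, 0 ≤ r → r < 1 → Real.circleAverage (fun z => ‖f z‖ ^ 2) 0 r ≤ C

/-- The scalar product of `f, g ∈ H²` equals `c`, that is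
`⟨f, g⟩ = lim_{r → 1-} (1 / 2π) ∫_0^{2π} f(r e^{iθ}) conj (g(r e^{iθ})) dθ = c`
(for `f, g ∈ H²` this limit exists and is the integral of `f conj g` over the unit circle with
respect to normalized Lebesgue measure). -/
def HasHardyInner (f g : ℂ → ℂ) (c : ℂ) : Prop :=
  Tendsto (fun r : ℝ => Real.circleAverage (fun z => f z * conj (g z)) 0 r) (𝓝[<] 1) (𝓝 c)

/-- `Θ` is an inner function: a bounded holomorphic function in the unit disc whose radial boundary
values exist and have modulus one at almost every point of the unit circle. -/
def IsInnerFunction (Θ : ℂ → ℂ) : Prop :=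
  DifferentiableOn ℂ Θ (ball 0 1) ∧
    (∃ C : ℝ, ∀ z ∈ ball (0 : ℂ) 1, ‖Θ z‖ ≤ C) ∧
    ∀ᵐ θ : ℝ, ∃ w : ℂ, ‖w‖ = 1 ∧
      Tendsto (fun r : ℝ => Θ (circleMap 0 r θ)) (𝓝[<] 1) (𝓝 w)

/-- `f` belongs to the model space `K_Θ = H² ⊖ Θ H²`. -/
def MemModelSpace (Θ f : ℂ → ℂ) : Prop :=
  IsHardyTwo f ∧ ∀ h : ℂ → ℂ, IsHardyTwo h → HasHardyInner f (fun z => Θ z * h z) 0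

/-- Arc length measure on the unit circle, in the parametrization `θ ↦ e^{iθ}`, `0 < θ ≤ 2π`. -/
noncomputable def arcMeasure : Measure ℝ :=
  volume.restrict (Set.Ioc 0 (2 * Real.pi))

/-- `g` is an `L^∞` function on the unit circle (only its values there are used) whose Cauchy
integral is `f`. -/
def IsCauchyRepresentation (f g : ℂ → ℂ) : Prop :=
  MemLp (fun θ : ℝ => g (circleMap 0 1 θ)) ∞ arcMeasure ∧
    ∀ ξ ∈ ball (0 : ℂ) 1,
      f ξ = (2 * Real.pi * Complex.I)⁻¹ * ∮ u in C(0, 1), g u / (u - ξ)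

/-- The `BMOA` norm of `f`, in `[0, ∞]`: the infimum of the `L^∞` norms of the bounded functions on
the circle whose Cauchy integral is `f`. It is `∞` if there is none, that is, if `f ∉ BMOA`. -/
noncomputable def bmoaNorm (f : ℂ → ℂ) : ℝ≥0∞ :=
  ⨅ (g : ℂ → ℂ) (_ : IsCauchyRepresentation f g),
    eLpNorm (fun θ : ℝ => g (circleMap 0 1 θ)) ∞ arcMeasure

/-- Area measure on the open unit disc, normalized to have mass one. -/
noncomputable def discArea : Measure ℂ :=
  ENNReal.ofReal Real.pi⁻¹ • volume.restrict (ball 0 1)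

/-- The norm, in `[0, ∞]`, of the weighted Bergman space `A_p(α)` with weight
`(1 - |u|²) ^ α`. -/
noncomputable def bergmanNorm (p α : ℝ) (f : ℂ → ℂ) : ℝ≥0∞ :=
  (∫⁻ u, ENNReal.ofReal ((1 - ‖u‖ ^ 2) ^ α * ‖f u‖ ^ p) ∂discArea) ^ (1 / p)

/-- The quantity `I_{p,α}(Θ)`, in `[0, ∞]`. -/
noncomputable def dynkinIntegral (p α : ℝ) (Θ : ℂ → ℂ) : ℝ≥0∞ :=
  ∫⁻ u, ENNReal.ofReal
    ((1 - ‖u‖ ^ 2) ^ α * ((1 - ‖Θ u‖ ^ 2) / (1 - ‖u‖ ^ 2)) ^ p) ∂discArea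

/-! The estimate is pointwise: `|f'(ξ)| ≤ ‖f‖_BMOA (1 - |Θ(ξ)|²) / (1 - |ξ|²)`; raising to the power
`p` and integrating gives the theorem. The derivative at `ξ` is the pairing of `f` with `z / (1 -
conj ξ z)²`. Since `f ⊥ Θ H²`, this kernel may be replaced by `z K²`, where `K = (1 - conj c Θ) / (1
- conj ξ z)` and `c = Θ(ξ)` (`MemModelSpace.tendsto_deriv`). If `f` is the Cauchy integral of `g`,
the pairing is at most `‖g‖_∞` times the mean of `|K|²`
(`IsCauchyRepresentation.norm_circleAverage_mul_conj_le`), and by the reproducing property that mean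
is at most `K(ξ)` in the limit (`circleAverage_sq_norm_modelKernel_le`). All integrals of
holomorphic functions are taken over circles of radius `r < 1`, with `r → 1` at the end, so boundary
values enter only in the bound `|Θ| ≤ 1`. -/

/-! ### Inner functions are bounded by one -/

theorem continuousOn_sphere_of_differentiableOn {f : ℂ → ℂ} (hf : DifferentiableOn ℂ f (ball 0 1))
    {r : ℝ} (hr : |r| < 1) : ContinuousOn f (sphere 0 |r|) :=
  hf.continuousOn.mono (sphere_subset_closedBall.trans (closedBall_subset_ball hr))

theorem diffContOnCl_of_differentiableOn {f : ℂ → ℂ} (hf : DifferentiableOn ℂ f (ball 0 1))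
    {r : ℝ} (hr : |r| < 1) : DiffContOnCl ℂ f (ball 0 |r|) :=
  hf.diffContOnCl_ball (closedBall_subset_ball hr)

/-- The Poisson formula for the dilates `Θ(r z)` bounds `|Θ(r w)|` by a Poisson mean of `|Θ|` on the
circle of radius `r`. By dominated convergence these means tend to the mean of the Poisson kernel,
which is 1. -/
theorem IsInnerFunction.norm_le_one {Θ : ℂ → ℂ} (hΘ : IsInnerFunction Θ) {w : ℂ}
    (hw : w ∈ ball (0 : ℂ) 1) : ‖Θ w‖ ≤ 1 := by
  obtain ⟨hd, ⟨C, hC⟩, hb⟩ := hΘ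
  have hw1 : ‖w‖ < 1 := by simpa using hw
  set P : ℂ → ℝ := fun z => (‖z - 0‖ ^ 2 - ‖w - 0‖ ^ 2) / ‖(z - 0) - (w - 0)‖ ^ 2 with hP
  have hne : ∀ z ∈ sphere (0 : ℂ) |1|, ‖(z - 0) - (w - 0)‖ ^ 2 ≠ 0 := by
    intro z hz h0
    have h1 : z = w := by simpa [sub_eq_zero] using h0
    have h2 : ‖z‖ = 1 := by simpa using hz
    rw [h1] at h2; linarith
  have hPc : ContinuousOn P (sphere 0 |1|) := by
    apply ContinuousOn.div (by fun_prop) (by fun_prop) hne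
  have hmap : ∀ θ : ℝ, circleMap 0 1 θ ∈ sphere (0 : ℂ) |1| := fun θ => by simp
  have hPcm : Continuous fun θ : ℝ => P (circleMap 0 1 θ) :=
    hPc.comp_continuous (by fun_prop) hmap
  have hPnn : ∀ θ : ℝ, 0 ≤ P (circleMap 0 1 θ) := by
    intro θ
    apply div_nonneg _ (by positivity)
    have : ‖w‖ ^ 2 ≤ 1 := by nlinarith [norm_nonneg w]
    simpa using this
  -- Real part of the Poisson formula for the constant function 1.
  have hP1 : Real.circleAverage P 0 1 = 1 := by
    have := (diffContOnCl_const (c := (1 : ℂ))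
      (s := ball (0 : ℂ) 1) (𝕜 := ℂ)).circleAverage_poissonKernel_smul' hw
    have h2 := congrArg Complex.re this
    have h3 := Complex.reCLM.circleAverage_comp_comm (c := 0) (R := 1)
      (f := fun z => P z • (1 : ℂ)) (by
        apply ContinuousOn.circleIntegrable'
        exact hPc.smul continuousOn_const)
    simp only [hP] at h3 ⊢
    simp only [Complex.reCLM_apply] at h3
    rw [h2] at h3
    simpa [Function.comp_def, -Complex.real_smul, Complex.smul_re] using h3
  have hlt : ∀ r : ℝ, r ∈ Set.Ioo (0 : ℝ) 1 → ∀ z ∈ closedBall (0 : ℂ) 1,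
      (r : ℂ) * z ∈ ball (0 : ℂ) 1 := by
    intro r hr z hz
    simp only [mem_closedBall, dist_zero_right, mem_ball] at hz ⊢
    rw [norm_mul, Complex.norm_real, Real.norm_of_nonneg hr.1.le]
    nlinarith [hr.1, hr.2, norm_nonneg z]
  have hev : ∀ᶠ r : ℝ in 𝓝[<] 1, r ∈ Set.Ioo (0 : ℝ) 1 := Ioo_mem_nhdsLT one_pos
  have hdil : ∀ r ∈ Set.Ioo (0 : ℝ) 1, DifferentiableOn ℂ (fun z => Θ (r * z)) (closedBall 0 1) :=
    fun r hr => hd.comp (by fun_prop) (hlt r hr)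
  have hcm : ∀ r θ : ℝ, (r : ℂ) * circleMap 0 1 θ = circleMap 0 r θ := by
    intro r θ; simp [circleMap]
  have hcont : ∀ r ∈ Set.Ioo (0 : ℝ) 1, Continuous fun θ : ℝ => Θ (circleMap 0 r θ) := by
    intro r hr
    have := (hdil r hr).continuousOn.comp_continuous (f := circleMap 0 1) (by fun_prop)
      (fun θ => by simp)
    simpa only [Function.comp_def, hcm] using this
  have key : ∀ r ∈ Set.Ioo (0 : ℝ) 1, ‖Θ (r * w)‖ ≤
      (2 * Real.pi)⁻¹ * ∫ θ in 0..2 * Real.pi, P (circleMap 0 1 θ) * ‖Θ (circleMap 0 r θ)‖ := by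
    intro r hr
    have h1 : DiffContOnCl ℂ (fun z => Θ (r * z)) (ball 0 1) := by
      refine ⟨(hdil r hr).mono ball_subset_closedBall, ?_⟩
      rw [closure_ball _ one_ne_zero]
      exact (hdil r hr).continuousOn
    have h2 := h1.circleAverage_poissonKernel_smul' hw
    rw [← h2, Real.circleAverage_def, norm_smul, Real.norm_of_nonneg (by positivity)]
    gcongr
    refine (intervalIntegral.norm_integral_le_integral_norm (by positivity)).trans_eq ?_
    refine intervalIntegral.integral_congr fun θ _ => ?_
    simp only [norm_smul, hcm]
    rw [Real.norm_of_nonneg (hPnn θ)]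
  have hlim : Tendsto (fun r : ℝ => (2 * Real.pi)⁻¹ *
      ∫ θ in 0..2 * Real.pi, P (circleMap 0 1 θ) * ‖Θ (circleMap 0 r θ)‖) (𝓝[<] 1)
      (𝓝 (Real.circleAverage P 0 1)) := by
    rw [Real.circleAverage_def, smul_eq_mul]
    refine Tendsto.const_mul _ ?_
    refine intervalIntegral.tendsto_integral_filter_of_dominated_convergence
      (fun θ => P (circleMap 0 1 θ) * C) ?_ ?_ ?_ ?_
    · filter_upwards [hev] with r hr
      exact (hPcm.mul (hcont r hr).norm).aestronglyMeasurable
    · filter_upwards [hev] with r hr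
      filter_upwards with θ _
      rw [norm_mul, Real.norm_of_nonneg (hPnn θ), norm_norm]
      refine mul_le_mul_of_nonneg_left (hC _ ?_) (hPnn θ)
      rw [← hcm]
      exact hlt r hr _ (by simp)
    · exact (hPcm.mul continuous_const).intervalIntegrable _ _
    · filter_upwards [hb] with θ hθ _
      obtain ⟨v, hv, ht⟩ := hθ
      simpa [hv] using ht.norm.const_mul (P (circleMap 0 1 θ))
  have hL : Tendsto (fun r : ℝ => ‖Θ (r * w)‖) (𝓝[<] 1) (𝓝 ‖Θ w‖) := by
    have hc : ContinuousAt Θ w := hd.continuousOn.continuousAt (isOpen_ball.mem_nhds hw)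
    have h1 : Tendsto (fun r : ℝ => (r : ℂ) * w) (𝓝[<] 1) (𝓝 w) := by
      have : Continuous fun r : ℝ => (r : ℂ) * w := by fun_prop
      simpa using (this.tendsto 1).mono_left nhdsWithin_le_nhds
    exact (hc.tendsto.comp h1).norm
  rw [hP1] at hlim
  exact le_of_tendsto_of_tendsto hL hlim (hev.mono key)

/-! ### Kernels on circles of radius `r < 1` -/

/-- The pairing with `z ↦ z / (1 - conj ξ z) ^ 2` evaluates derivatives. -/
theorem circleAverage_mul_conj_derivKernel {f : ℂ → ℂ} (hf : DifferentiableOn ℂ f (ball 0 1))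
    {ξ : ℂ} (hξ : ξ ∈ ball (0 : ℂ) 1) {r : ℝ} (hr : r ∈ Set.Ioo (0 : ℝ) 1) :
    Real.circleAverage (fun z => f z * conj (z / (1 - conj ξ * z) ^ 2)) 0 r =
      r ^ 2 * deriv f (r ^ 2 * ξ) := by
  have hξ1 : ‖ξ‖ < 1 := by simpa using hξ
  have hmem : (r : ℂ) ^ 2 * ξ ∈ ball (0 : ℂ) r := by
    simp only [mem_ball, dist_zero_right, norm_mul, norm_pow, Complex.norm_real,
      Real.norm_of_nonneg hr.1.le]
    nlinarith [hr.1, hr.2, norm_nonneg ξ, mul_pos hr.1 hr.1]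
  rw [← Complex.two_pi_I_inv_smul_circleIntegral_sub_sq_inv_smul_of_differentiable isOpen_ball
    (closedBall_subset_ball hr.2) hf hmem, Real.circleAverage_eq_circleIntegral hr.1.ne',
    smul_eq_mul, smul_eq_mul, mul_left_comm]
  congr 1
  rw [← circleIntegral.integral_const_mul]
  refine circleIntegral.integral_congr hr.1.le fun z hz => ?_
  have hz : ‖z‖ = r := by simpa using hz
  have hz0 : z ≠ 0 := by rintro rfl; simp at hz; linarith [hr.1]
  -- On `|z| = r` this turns the conjugated kernel into a Cauchy kernel with pole at `r² ξ`.
  have hcz : conj z = (r : ℂ) ^ 2 / z := by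
    rw [eq_div_iff hz0, ← hz, mul_comm, Complex.mul_conj']
  have h1 : z - (r : ℂ) ^ 2 * ξ ≠ 0 := by
    intro h0
    rw [← sub_eq_zero.1 h0] at hmem
    simp [hz] at hmem
  have h2 : 1 - ξ * ((r : ℂ) ^ 2 / z) ≠ 0 := by
    intro h0; apply h1; field_simp at h0; linear_combination h0
  simp only [map_div₀, map_pow, map_sub, map_one, map_mul, Complex.conj_conj, hcz, sub_zero,
    smul_eq_mul]
  have h3 : 1 - ξ * ((r : ℂ) ^ 2 / z) = (z - r ^ 2 * ξ) / z := by field_simp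
  rw [h3]
  field_simp

theorem one_sub_conj_mul_ne_zero {ξ z : ℂ} (hξ : ξ ∈ ball (0 : ℂ) 1) (hz : z ∈ ball (0 : ℂ) 1) :
    1 - conj ξ * z ≠ 0 := by
  intro h0
  have h1 : ‖conj ξ * z‖ = 1 := by rw [← sub_eq_zero.1 h0]; simp
  simp only [mem_ball, dist_zero_right] at hξ hz
  rw [norm_mul, Complex.norm_conj] at h1
  nlinarith [norm_nonneg ξ, norm_nonneg z]

/-- As `|Θ| ≤ 1`, `|1 - conj c Θ|² ≤ Re (1 + |c|² - 2 conj c Θ)`, which is the real part of a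
holomorphic function. On `|z| = r` the factor `1 / |1 - conj ξ z|²` is the Cauchy kernel for `r² ξ`
times `1 / (1 - conj ξ z)`, so Cauchy's formula evaluates the mean of the majorant. -/
theorem circleAverage_sq_norm_modelKernel_le {Θ : ℂ → ℂ} (hd : DifferentiableOn ℂ Θ (ball 0 1))
    (hΘ : ∀ z ∈ ball (0 : ℂ) 1, ‖Θ z‖ ≤ 1) {ξ : ℂ} (hξ : ξ ∈ ball (0 : ℂ) 1) (c : ℂ)
    {r : ℝ} (hr : r ∈ Set.Ioo (0 : ℝ) 1) :
    Real.circleAverage (fun z => ‖(1 - conj c * Θ z) / (1 - conj ξ * z)‖ ^ 2) 0 r ≤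
      ((1 + ‖c‖ ^ 2 - 2 * conj c * Θ (r ^ 2 * ξ)) / (1 - conj ξ * (r ^ 2 * ξ))).re := by
  have hξ1 : ‖ξ‖ < 1 := by simpa using hξ
  have habs : |r| < 1 := by rw [abs_of_pos hr.1]; exact hr.2
  have hmem : (r : ℂ) ^ 2 * ξ ∈ ball (0 : ℂ) |r| := by
    simp only [mem_ball, dist_zero_right, norm_mul, norm_pow, Complex.norm_real,
      Real.norm_of_nonneg hr.1.le, abs_of_pos hr.1]
    nlinarith [hr.1, hr.2, norm_nonneg ξ, mul_pos hr.1 hr.1]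
  set F : ℂ → ℂ := fun z => (1 + ‖c‖ ^ 2 - 2 * conj c * Θ z) / (1 - conj ξ * z) with hF
  have hFd : DifferentiableOn ℂ F (ball 0 1) := by
    apply DifferentiableOn.div (by fun_prop) (by fun_prop)
    exact fun z hz => one_sub_conj_mul_ne_zero hξ hz
  have hA := (diffContOnCl_of_differentiableOn hFd habs).circleAverage_smul_div hmem
  have hne : ∀ z ∈ sphere (0 : ℂ) |r|, z - (r : ℂ) ^ 2 * ξ ≠ 0 := by
    intro z hz h0
    rw [← sub_eq_zero.1 h0] at hmem
    simp at hz
    simp [hz] at hmem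
  have hci : CircleIntegrable (fun z => ((z - 0) / (z - r ^ 2 * ξ)) • F z) 0 r := by
    apply ContinuousOn.circleIntegrable'
    exact (ContinuousOn.div (by fun_prop) (by fun_prop) hne).smul
      (continuousOn_sphere_of_differentiableOn hFd habs)
  have hB := Complex.reCLM.circleAverage_comp_comm hci
  rw [hA] at hB
  change _ ≤ (F (r ^ 2 * ξ)).re
  rw [← Complex.reCLM_apply, ← hB]
  apply Real.circleAverage_mono
  · apply ContinuousOn.circleIntegrable'
    refine ((ContinuousOn.div ?_ (by fun_prop) ?_).norm).pow 2
    · have := continuousOn_sphere_of_differentiableOn hd habs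
      fun_prop
    · intro z hz
      exact one_sub_conj_mul_ne_zero hξ (sphere_subset_closedBall.trans
        (closedBall_subset_ball habs) hz)
  · apply ContinuousOn.circleIntegrable'
    exact Complex.continuous_re.comp_continuousOn ((ContinuousOn.div (by fun_prop) (by fun_prop)
      hne).smul (continuousOn_sphere_of_differentiableOn hFd habs))
  · intro z hz
    have hzb : z ∈ ball (0 : ℂ) 1 :=
      sphere_subset_closedBall.trans (closedBall_subset_ball habs) hz
    have h1 := one_sub_conj_mul_ne_zero hξ hzb
    have h2 := hne z hz
    have hz : ‖z‖ = r := by simpa [abs_of_pos hr.1] using hz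
    have hz0 : z ≠ 0 := by rintro rfl; simp at hz; linarith [hr.1]
    have h3 : ((z - 0) / (z - r ^ 2 * ξ)) • F z =
        (1 + ‖c‖ ^ 2 - 2 * conj c * Θ z) * (((‖1 - conj ξ * z‖ ^ 2)⁻¹ : ℝ) : ℂ) := by
      have h4 : ((‖1 - conj ξ * z‖ ^ 2 : ℝ) : ℂ) = (1 - conj ξ * z) * ((z - r ^ 2 * ξ) / z) := by
        push_cast
        rw [← Complex.mul_conj']
        congr 1
        have hcz : conj z = (r : ℂ) ^ 2 / z := by
          rw [eq_div_iff hz0, ← hz, mul_comm, Complex.mul_conj']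
        simp only [map_sub, map_one, map_mul, Complex.conj_conj, hcz]
        field_simp
      rw [Complex.ofReal_inv, h4, hF, smul_eq_mul]
      field_simp
      simp
    simp only [Function.comp_apply, Complex.reCLM_apply]
    rw [h3, Complex.re_mul_ofReal, norm_div, div_pow, div_eq_mul_inv]
    gcongr
    have h5 : ‖1 - conj c * Θ z‖ ^ 2 = 1 + ‖c‖ ^ 2 * ‖Θ z‖ ^ 2 - 2 * (conj c * Θ z).re := by
      rw [← Complex.normSq_eq_norm_sq, Complex.normSq_sub, Complex.normSq_eq_norm_sq,
        Complex.normSq_eq_norm_sq (conj c * Θ z), norm_mul, Complex.norm_conj, mul_pow]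
      simp
    rw [h5]
    have h6 : ((1 : ℂ) + ‖c‖ ^ 2 - 2 * conj c * Θ z).re =
        1 + ‖c‖ ^ 2 - 2 * (conj c * Θ z).re := by
      rw [mul_assoc, ← Complex.ofReal_pow, ← Complex.ofReal_ofNat]
      simp only [Complex.sub_re, Complex.add_re, Complex.ofReal_re, Complex.re_ofReal_mul,
        Complex.one_re]
    rw [h6]
    have h7 : ‖Θ z‖ ^ 2 ≤ 1 := pow_le_one₀ (norm_nonneg _) (hΘ z hzb)
    nlinarith [sq_nonneg ‖c‖]

/-! ### Pairing a Cauchy integral with a holomorphic function -/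

theorem conj_circleAverage (F : ℂ → ℂ) (c : ℂ) (r : ℝ) :
    conj (Real.circleAverage F c r) = Real.circleAverage (fun z => conj (F z)) c r := by
  rw [Real.circleAverage_def, Real.circleAverage_def,
    intervalIntegral.integral_of_le (by positivity), intervalIntegral.integral_of_le (by positivity),
    integral_conj, Complex.real_smul, Complex.real_smul, map_mul, Complex.conj_ofReal]

/-- The Cauchy kernel as a function of the conjugate variable reproduces values of `L`. -/
theorem circleAverage_conj_mul_cauchyKernel {L : ℂ → ℂ} (hL : DifferentiableOn ℂ L (ball 0 1))
    {r : ℝ} (hr : r ∈ Set.Ioo (0 : ℝ) 1) {σ : ℂ} (hσ : ‖σ‖ = 1) :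
    Real.circleAverage (fun z => conj (L z) * (σ / (σ - z))) 0 r = conj (L (r ^ 2 * σ)) := by
  have habs : |r| < 1 := by rw [abs_of_pos hr.1]; exact hr.2
  have hmem : (r : ℂ) ^ 2 * σ ∈ ball (0 : ℂ) |r| := by
    simp only [mem_ball, dist_zero_right, norm_mul, norm_pow, Complex.norm_real, hσ,
      Real.norm_of_nonneg hr.1.le, abs_of_pos hr.1]
    nlinarith [hr.1, hr.2]
  rw [← (diffContOnCl_of_differentiableOn hL habs).circleAverage_smul_div hmem,
    conj_circleAverage]
  refine Real.circleAverage_congr_sphere fun z hz => ?_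
  have hz : ‖z‖ = r := by simpa [abs_of_pos hr.1] using hz
  have hz0 : z ≠ 0 := by rintro rfl; simp at hz; linarith [hr.1]
  have hσ0 : σ ≠ 0 := by rintro rfl; simp at hσ
  have hcz : (r : ℂ) ^ 2 = conj z * z := by
    rw [← hz, mul_comm, Complex.mul_conj']
  have hcσ : conj σ = 1 / σ := by
    rw [eq_div_iff hσ0, mul_comm, Complex.mul_conj', hσ]; simp
  have h1 : σ - z ≠ 0 := by
    intro h0
    rw [sub_eq_zero.1 h0, hz] at hσ; linarith [hr.2]
  have h2 : conj z ≠ 0 := by simpa using hz0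
  simp only [sub_zero, smul_eq_mul, map_mul, map_div₀, map_sub, hcz, hcσ,
    Complex.conj_conj]
  have h3 : conj z - z * conj z * (1 / σ) = conj z * ((σ - z) / σ) := by field_simp
  rw [h3]
  field_simp

theorem ae_norm_le_of_memLp_top {g : ℝ → ℂ} (hg : MemLp g ∞ arcMeasure) :
    ∀ᵐ θ ∂arcMeasure, ‖g θ‖ ≤ (eLpNorm g ∞ arcMeasure).toReal := by
  rw [eLpNorm_exponent_top]
  have hfin : eLpNormEssSup g arcMeasure ≠ ∞ := by
    rw [← eLpNorm_exponent_top]; exact hg.2.ne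
  filter_upwards [enorm_ae_le_eLpNormEssSup g arcMeasure] with θ hθ
  rw [← toReal_enorm]
  exact ENNReal.toReal_mono hfin hθ

/-- The pairing with a Cauchy integral is the pairing with its density. -/
theorem IsCauchyRepresentation.circleAverage_mul_conj {f g L : ℂ → ℂ}
    (hg : IsCauchyRepresentation f g) (hL : DifferentiableOn ℂ L (ball 0 1))
    {r : ℝ} (hr : r ∈ Set.Ioo (0 : ℝ) 1) :
    Real.circleAverage (fun z => f z * conj (L z)) 0 r =
      (2 * Real.pi)⁻¹ • ∫ θ, g (circleMap 0 1 θ) * conj (L (r ^ 2 * circleMap 0 1 θ))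
        ∂arcMeasure := by
  have habs : |r| < 1 := by rw [abs_of_pos hr.1]; exact hr.2
  have hfin : IsFiniteMeasure arcMeasure := by
    unfold arcMeasure; infer_instance
  have hb : ∀ φ : ℝ, circleMap 0 r φ ∈ ball (0 : ℂ) 1 := fun φ => by simpa using habs
  have hne : ∀ θ φ : ℝ, circleMap 0 1 θ - circleMap 0 r φ ≠ 0 := by
    intro θ φ h0
    have := hb φ
    rw [← sub_eq_zero.1 h0] at this
    simp at this
  have hLc : Continuous fun φ : ℝ => L (circleMap 0 r φ) :=
    hL.continuousOn.comp_continuous (by fun_prop) hb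
  have hf : ∀ φ : ℝ, f (circleMap 0 r φ) = (2 * Real.pi)⁻¹ • ∫ θ, g (circleMap 0 1 θ) *
      (circleMap 0 1 θ / (circleMap 0 1 θ - circleMap 0 r φ)) ∂arcMeasure := by
    intro φ
    rw [hg.2 _ (hb φ), circleIntegral, intervalIntegral.integral_of_le (by positivity), arcMeasure,
      ← integral_const_mul, ← integral_smul]
    congr 1
    ext θ
    simp only [deriv_circleMap, smul_eq_mul, Complex.real_smul]
    have := hne θ φ
    have hpi : (Real.pi : ℂ) ≠ 0 := by exact_mod_cast Real.pi_ne_zero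
    push_cast
    field_simp [Complex.I_ne_zero]
  set H : ℝ → ℝ → ℂ := fun φ θ => g (circleMap 0 1 θ) * (conj (L (circleMap 0 r φ)) *
      (circleMap 0 1 θ / (circleMap 0 1 θ - circleMap 0 r φ))) with hH
  have hQ : Continuous fun x : ℝ × ℝ => conj (L (circleMap 0 r x.1)) *
      (circleMap 0 1 x.2 / (circleMap 0 1 x.2 - circleMap 0 r x.1)) := by
    refine Continuous.mul ?_ (Continuous.div ?_ ?_ fun x => hne _ _)
    · exact Complex.continuous_conj.comp (hLc.comp continuous_fst)
    · exact (continuous_circleMap 0 1).comp continuous_snd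
    · exact ((continuous_circleMap 0 1).comp continuous_snd).sub
        ((continuous_circleMap 0 r).comp continuous_fst)
  have hQb : ∃ B : ℝ, ∀ x : ℝ × ℝ, ‖conj (L (circleMap 0 r x.1)) *
      (circleMap 0 1 x.2 / (circleMap 0 1 x.2 - circleMap 0 r x.1))‖ ≤ B := by
    obtain ⟨B, hB⟩ := (isCompact_sphere (0 : ℂ) |r|).exists_bound_of_continuousOn
      (continuousOn_sphere_of_differentiableOn hL habs)
    refine ⟨B * (1 / (1 - r)), fun x => ?_⟩
    have hBx := hB (circleMap 0 r x.1) (circleMap_mem_sphere' 0 r x.1)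
    have hn : 1 - r ≤ ‖circleMap 0 1 x.2 - circleMap 0 r x.1‖ := by
      refine le_trans ?_ (norm_sub_norm_le _ _)
      simp [abs_of_pos hr.1]
    have h1r : 0 < 1 - r := by linarith [hr.2]
    rw [norm_mul, norm_div, Complex.norm_conj]
    have : ‖circleMap 0 1 x.2‖ = 1 := by simp
    rw [this]
    gcongr
    exact (norm_nonneg _).trans hBx
  -- Justifies Fubini: the kernel is bounded since the two circles are at distance `1 - r`.
  have hint : Integrable (Function.uncurry H) (arcMeasure.prod arcMeasure) := by
    obtain ⟨B, hB⟩ := hQb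
    have h1 : Integrable (fun x : ℝ × ℝ => g (circleMap 0 1 x.2)) (arcMeasure.prod arcMeasure) :=
      (hg.1.integrable le_top).comp_snd arcMeasure
    exact h1.mul_bdd hQ.aestronglyMeasurable (Eventually.of_forall hB)
  have e1 : Real.circleAverage (fun z => f z * conj (L z)) 0 r =
      (2 * Real.pi)⁻¹ • ∫ φ, (2 * Real.pi)⁻¹ • ∫ θ, H φ θ ∂arcMeasure ∂arcMeasure := by
    rw [Real.circleAverage_def, intervalIntegral.integral_of_le (by positivity)]
    congr 1
    change _ = ∫ φ, _ ∂(volume.restrict _)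
    congr 1
    ext φ
    rw [hf φ, smul_mul_assoc, ← integral_mul_const]
    congr 2
    ext θ
    simp only [hH]; ring
  rw [e1, integral_smul, integral_integral_swap hint, ← integral_smul]
  congr 2
  ext θ
  simp only [hH]
  rw [integral_const_mul, ← circleAverage_conj_mul_cauchyKernel hL hr (σ := circleMap 0 1 θ)
    (by simp), Real.circleAverage_def, intervalIntegral.integral_of_le (by positivity), arcMeasure,
    mul_smul_comm]

/-- The radius `r²` arises because both `f` and `L` are evaluated at radius `r`, while `g` lives on
the unit circle. -/
theorem IsCauchyRepresentation.norm_circleAverage_mul_conj_le {f g L : ℂ → ℂ}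
    (hg : IsCauchyRepresentation f g) (hL : DifferentiableOn ℂ L (ball 0 1))
    {r : ℝ} (hr : r ∈ Set.Ioo (0 : ℝ) 1) :
    ‖Real.circleAverage (fun z => f z * conj (L z)) 0 r‖ ≤
      (eLpNorm (fun θ : ℝ => g (circleMap 0 1 θ)) ∞ arcMeasure).toReal *
        Real.circleAverage (fun z => ‖L z‖) 0 (r ^ 2) := by
  have hfin : IsFiniteMeasure arcMeasure := by
    unfold arcMeasure; infer_instance
  have hcm : ∀ θ : ℝ, (r : ℂ) ^ 2 * circleMap 0 1 θ = circleMap 0 (r ^ 2) θ := by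
    intro θ; simp [circleMap]
  have hLc : Continuous fun θ : ℝ => L (circleMap 0 (r ^ 2) θ) := by
    refine hL.continuousOn.comp_continuous (by fun_prop) fun φ => ?_
    simpa using pow_lt_one₀ hr.1.le hr.2 two_ne_zero
  rw [hg.circleAverage_mul_conj hL hr, Real.circleAverage_def, norm_smul,
    Real.norm_of_nonneg (by positivity), smul_eq_mul, mul_left_comm,
    intervalIntegral.integral_of_le (by positivity), ← integral_const_mul]
  gcongr
  refine norm_integral_le_of_norm_le ?_ ?_
  · refine Integrable.const_mul ?_ _
    exact (hLc.norm.integrableOn_Icc).mono_set Set.Ioc_subset_Icc_self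
  · filter_upwards [ae_norm_le_of_memLp_top hg.1] with θ hθ
    rw [norm_mul, Complex.norm_conj, hcm]
    gcongr

/-! ### Derivatives in the model space -/

theorem isHardyTwo_of_bounded {h : ℂ → ℂ} (hd : DifferentiableOn ℂ h (ball 0 1)) {C : ℝ}
    (hC : ∀ z ∈ ball (0 : ℂ) 1, ‖h z‖ ≤ C) : IsHardyTwo h := by
  refine ⟨hd, C ^ 2, fun r hr0 hr1 => ?_⟩
  have habs : |r| < 1 := by rwa [abs_of_nonneg hr0]
  refine Real.circleAverage_mono_on_of_le_circle ?_ fun z hz => ?_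
  · apply ContinuousOn.circleIntegrable'
    exact (continuousOn_sphere_of_differentiableOn hd habs).norm.pow 2
  · have := hC z (sphere_subset_closedBall.trans (closedBall_subset_ball habs) hz)
    gcongr

/-- Modulo `Θ H²`, the function `z K(z) ^ 2`, with `K` a multiple of the reproducing kernel of
`K_Θ` at `ξ`, is the kernel of the derivative at `ξ`. -/
theorem MemModelSpace.tendsto_deriv {Θ f : ℂ → ℂ} (hf : MemModelSpace Θ f)
    (hd : DifferentiableOn ℂ Θ (ball 0 1)) (hΘ : ∀ z ∈ ball (0 : ℂ) 1, ‖Θ z‖ ≤ 1)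
    {ξ : ℂ} (hξ : ξ ∈ ball (0 : ℂ) 1) (c : ℂ) :
    HasHardyInner f (fun z => z * ((1 - conj c * Θ z) / (1 - conj ξ * z)) ^ 2) (deriv f ξ) := by
  have hξ1 : ‖ξ‖ < 1 := by simpa using hξ
  obtain ⟨⟨hfd, -⟩, horth⟩ := hf
  -- From `1 - (1 - w)² = w (2 - w)` with `w = conj c Θ`: the two kernels differ by `Θ h`.
  set h : ℂ → ℂ := fun z => z * (2 * conj c - conj c ^ 2 * Θ z) / (1 - conj ξ * z) ^ 2 with hh
  have hne : ∀ z ∈ ball (0 : ℂ) 1, (1 - conj ξ * z) ^ 2 ≠ 0 :=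
    fun z hz => pow_ne_zero 2 (one_sub_conj_mul_ne_zero hξ hz)
  have hhd : DifferentiableOn ℂ h (ball 0 1) :=
    DifferentiableOn.div (by fun_prop) (by fun_prop) hne
  have hhb : ∀ z ∈ ball (0 : ℂ) 1,
      ‖h z‖ ≤ 1 * (2 * ‖c‖ + ‖c‖ ^ 2 * 1) / (1 - ‖ξ‖) ^ 2 := by
    intro z hz
    have hz1 : ‖z‖ < 1 := by simpa using hz
    have h1 : 1 - ‖ξ‖ ≤ ‖1 - conj ξ * z‖ := by
      have := norm_sub_norm_le (1 : ℂ) (conj ξ * z)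
      rw [norm_mul, Complex.norm_conj, norm_one] at this
      nlinarith [norm_nonneg ξ]
    have h0 : 0 < 1 - ‖ξ‖ := by linarith
    have h2 : ‖2 * conj c - conj c ^ 2 * Θ z‖ ≤ 2 * ‖c‖ + ‖c‖ ^ 2 * 1 := by
      refine (norm_sub_le _ _).trans ?_
      rw [norm_mul, norm_mul, norm_pow, Complex.norm_conj, Complex.norm_ofNat]
      gcongr
      exact hΘ z hz
    rw [hh, norm_div, norm_mul, norm_pow]
    gcongr
  have hk : ContinuousOn (fun z => z / (1 - conj ξ * z) ^ 2) (ball 0 1) :=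
    ContinuousOn.div (by fun_prop) (by fun_prop) hne
  have hlim0 := horth h (isHardyTwo_of_bounded hhd hhb)
  have hlim1 : Tendsto (fun r : ℝ => (r : ℂ) ^ 2 * deriv f (r ^ 2 * ξ)) (𝓝[<] 1)
      (𝓝 (deriv f ξ)) := by
    have hc : ContinuousAt (deriv f) ξ :=
      ((hfd.deriv isOpen_ball).continuousOn).continuousAt (isOpen_ball.mem_nhds hξ)
    have h1 : Tendsto (fun r : ℝ => (r : ℂ) ^ 2) (𝓝[<] 1) (𝓝 1) := by
      have : Continuous fun r : ℝ => (r : ℂ) ^ 2 := by fun_prop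
      simpa using (this.tendsto 1).mono_left nhdsWithin_le_nhds
    have h2 : Tendsto (fun r : ℝ => (r : ℂ) ^ 2 * ξ) (𝓝[<] 1) (𝓝 ξ) := by
      simpa using h1.mul_const ξ
    simpa using h1.mul (hc.tendsto.comp h2)
  have hdiff := hlim1.sub hlim0
  rw [sub_zero] at hdiff
  refine hdiff.congr' ?_
  filter_upwards [Ioo_mem_nhdsLT one_pos] with r hr
  have habs : |r| < 1 := by rw [abs_of_pos hr.1]; exact hr.2
  have hsub : sphere (0 : ℂ) |r| ⊆ ball 0 1 :=
    sphere_subset_closedBall.trans (closedBall_subset_ball habs)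
  rw [← circleAverage_mul_conj_derivKernel hfd hξ hr, ← Real.circleAverage_fun_sub]
  · refine Real.circleAverage_congr_sphere fun z hz => ?_
    have hz := hne z (hsub hz)
    simp only [← mul_sub, ← map_sub, hh]
    congr 2
    have hz' : 1 - conj ξ * z ≠ 0 := fun h0 => hz (by rw [h0]; simp)
    field_simp
    ring
  · apply ContinuousOn.circleIntegrable'
    exact (hfd.continuousOn.mono hsub).mul
      (Complex.continuous_conj.comp_continuousOn (hk.mono hsub))
  · apply ContinuousOn.circleIntegrable'
    exact (hfd.continuousOn.mono hsub).mul (Complex.continuous_conj.comp_continuousOn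
      ((hd.continuousOn.mono hsub).mul (hhd.continuousOn.mono hsub)))

theorem MemModelSpace.norm_deriv_le_of_isCauchyRepresentation {Θ f g : ℂ → ℂ}
    (hf : MemModelSpace Θ f) (hd : DifferentiableOn ℂ Θ (ball 0 1))
    (hΘ : ∀ z ∈ ball (0 : ℂ) 1, ‖Θ z‖ ≤ 1) (hg : IsCauchyRepresentation f g)
    {ξ : ℂ} (hξ : ξ ∈ ball (0 : ℂ) 1) :
    ‖deriv f ξ‖ ≤ (eLpNorm (fun θ : ℝ => g (circleMap 0 1 θ)) ∞ arcMeasure).toReal *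
      ((1 - ‖Θ ξ‖ ^ 2) / (1 - ‖ξ‖ ^ 2)) := by
  set N := (eLpNorm (fun θ : ℝ => g (circleMap 0 1 θ)) ∞ arcMeasure).toReal with hN
  -- This choice makes the limiting bound `(1 + |c|² - 2 conj c Θ(ξ)) / (1 - |ξ|²)` collapse to the
  -- required quotient.
  set c := Θ ξ with hc
  set F : ℝ → ℝ := fun ρ =>
    ((1 + ‖c‖ ^ 2 - 2 * conj c * Θ (ρ ^ 2 * ξ)) / (1 - conj ξ * (ρ ^ 2 * ξ))).re with hF
  have hLd : DifferentiableOn ℂ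
      (fun z => z * ((1 - conj c * Θ z) / (1 - conj ξ * z)) ^ 2) (ball 0 1) := by
    refine DifferentiableOn.mul (by fun_prop) (DifferentiableOn.pow ?_ 2)
    exact DifferentiableOn.div (by fun_prop) (by fun_prop)
      fun z hz => one_sub_conj_mul_ne_zero hξ hz
  have hlim := (hf.tendsto_deriv hd hΘ hξ c).norm
  have hFlim : Tendsto (fun r : ℝ => N * F (r ^ 2)) (𝓝[<] 1)
      (𝓝 (N * ((1 - ‖c‖ ^ 2) / (1 - ‖ξ‖ ^ 2)))) := by
    refine Tendsto.const_mul _ ?_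
    have h1 : Tendsto (fun r : ℝ => (((r ^ 2 : ℝ) : ℂ)) ^ 2 * ξ) (𝓝[<] 1) (𝓝 ξ) := by
      have : Continuous fun r : ℝ => (((r ^ 2 : ℝ) : ℂ)) ^ 2 * ξ := by fun_prop
      simpa using (this.tendsto 1).mono_left nhdsWithin_le_nhds
    have h2 : Tendsto (fun r : ℝ => Θ ((((r ^ 2 : ℝ) : ℂ)) ^ 2 * ξ)) (𝓝[<] 1) (𝓝 c) :=
      (hd.continuousOn.continuousAt (isOpen_ball.mem_nhds hξ)).tendsto.comp h1
    have h3 := ((h2.const_mul (2 * conj c)).const_sub (1 + (‖c‖ : ℂ) ^ 2)).div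
      ((h1.const_mul (conj ξ)).const_sub 1) (one_sub_conj_mul_ne_zero hξ hξ)
    have h4 : (1 + (‖c‖ : ℂ) ^ 2 - 2 * conj c * c) / (1 - conj ξ * ξ) =
        (((1 - ‖c‖ ^ 2) / (1 - ‖ξ‖ ^ 2) : ℝ) : ℂ) := by
      rw [mul_assoc, Complex.conj_mul', Complex.conj_mul']
      push_cast
      ring
    rw [h4] at h3
    have h5 := (Complex.continuous_re.tendsto _).comp h3
    rwa [Complex.ofReal_re] at h5
  refine le_of_tendsto_of_tendsto hlim hFlim ?_
  filter_upwards [Ioo_mem_nhdsLT one_pos] with r hr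
  refine (hg.norm_circleAverage_mul_conj_le hLd hr).trans ?_
  have hr2 : r ^ 2 ∈ Set.Ioo (0 : ℝ) 1 := ⟨pow_pos hr.1 2, pow_lt_one₀ hr.1.le hr.2 two_ne_zero⟩
  have habs : |r ^ 2| < 1 := by rw [abs_of_pos hr2.1]; exact hr2.2
  have hsub : sphere (0 : ℂ) |r ^ 2| ⊆ ball 0 1 :=
    sphere_subset_closedBall.trans (closedBall_subset_ball habs)
  refine mul_le_mul_of_nonneg_left ?_ ENNReal.toReal_nonneg
  refine le_trans ?_ (circleAverage_sq_norm_modelKernel_le hd hΘ hξ c hr2)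
  apply Real.circleAverage_mono
  · apply ContinuousOn.circleIntegrable'
    exact (hLd.continuousOn.mono hsub).norm
  · apply ContinuousOn.circleIntegrable'
    refine ContinuousOn.pow (ContinuousOn.norm (ContinuousOn.div ?_ (by fun_prop) ?_)) 2
    · have := hd.continuousOn.mono hsub
      fun_prop
    · exact fun z hz => one_sub_conj_mul_ne_zero hξ (hsub hz)
  -- The factor `z` of the kernel has modulus below 1 and is dropped.
  · intro z hz
    have hz1 : ‖z‖ < 1 := by simpa using hsub hz
    simp only [norm_mul, norm_pow]
    exact mul_le_of_le_one_left (by positivity) hz1.le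

/-- By the maximum principle `Θ` is constant, so the kernel with `c = Θ(ξ)` vanishes identically.
This settles the case `∞ · 0` of the pointwise estimate. -/
theorem MemModelSpace.deriv_eq_zero_of_norm_eq_one {Θ f : ℂ → ℂ}
    (hf : MemModelSpace Θ f) (hd : DifferentiableOn ℂ Θ (ball 0 1))
    (hΘ : ∀ z ∈ ball (0 : ℂ) 1, ‖Θ z‖ ≤ 1) {ξ : ℂ} (hξ : ξ ∈ ball (0 : ℂ) 1)
    (h1 : ‖Θ ξ‖ = 1) : deriv f ξ = 0 := by
  have hconst : Set.EqOn Θ (Function.const ℂ (Θ ξ)) (ball 0 1) := by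
    refine Complex.eqOn_of_isPreconnected_of_isMaxOn_norm (convex_ball _ _).isPreconnected
      isOpen_ball hd hξ fun z hz => ?_
    simpa [h1] using hΘ z hz
  refine tendsto_nhds_unique (hf.tendsto_deriv hd hΘ hξ (Θ ξ)) ?_
  refine tendsto_const_nhds.congr' ?_
  filter_upwards [Ioo_mem_nhdsLT one_pos] with r hr
  have habs : |r| < 1 := by rw [abs_of_pos hr.1]; exact hr.2
  rw [Real.circleAverage_congr_sphere (f₂ := fun _ => (0 : ℂ)), Real.circleAverage_const]
  intro z hz
  have hz := hconst (sphere_subset_closedBall.trans (closedBall_subset_ball habs) hz)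
  simp only [Function.const_apply] at hz
  simp [hz, Complex.conj_mul', h1]

/-! ### The pointwise estimate in `[0, ∞]` and its integration -/

theorem MemModelSpace.ofReal_norm_deriv_le {Θ f : ℂ → ℂ} (hΘ : IsInnerFunction Θ)
    (hf : MemModelSpace Θ f) {ξ : ℂ} (hξ : ξ ∈ ball (0 : ℂ) 1) :
    ENNReal.ofReal ‖deriv f ξ‖ ≤
      bmoaNorm f * ENNReal.ofReal ((1 - ‖Θ ξ‖ ^ 2) / (1 - ‖ξ‖ ^ 2)) := by
  have hb : ∀ z ∈ ball (0 : ℂ) 1, ‖Θ z‖ ≤ 1 := fun z hz => hΘ.norm_le_one hz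
  rcases eq_or_lt_of_le (hb ξ hξ) with h1 | h1
  · simp [hf.deriv_eq_zero_of_norm_eq_one hΘ.1 hb hξ h1]
  have hξ1 : ‖ξ‖ < 1 := by simpa using hξ
  have hpos : 0 < (1 - ‖Θ ξ‖ ^ 2) / (1 - ‖ξ‖ ^ 2) :=
    div_pos (sub_pos.2 (pow_lt_one₀ (norm_nonneg _) h1 two_ne_zero))
      (sub_pos.2 (pow_lt_one₀ (norm_nonneg _) hξ1 two_ne_zero))
  -- Dividing by the positive finite factor isolates the infimum, so that each `g` can be treated
  -- separately.
  rw [← ENNReal.div_le_iff (ENNReal.ofReal_pos.2 hpos).ne' ENNReal.ofReal_ne_top]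
  refine le_iInf₂ fun g hg => ?_
  rw [ENNReal.div_le_iff (ENNReal.ofReal_pos.2 hpos).ne' ENNReal.ofReal_ne_top]
  refine (ENNReal.ofReal_le_ofReal
    (hf.norm_deriv_le_of_isCauchyRepresentation hΘ.1 hb hg hξ)).trans_eq ?_
  rw [ENNReal.ofReal_mul ENNReal.toReal_nonneg, ENNReal.ofReal_toReal hg.1.2.ne]

theorem proposition4p2 (Θ f : ℂ → ℂ) (p α : ℝ) (hα : -1 < α) (hp : 1 < p)
    (hΘ : IsInnerFunction Θ) (hf : MemModelSpace Θ f) :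
    bergmanNorm p α (deriv f) ≤ bmoaNorm f * dynkinIntegral p α Θ ^ (1 / p) := by
  have hp0 : 0 < p := one_pos.trans hp
  have hcont := hΘ.1.continuousOn
  have hpos : ∀ u ∈ ball (0 : ℂ) 1, 0 < 1 - ‖u‖ ^ 2 := fun u hu =>
    sub_pos.2 (pow_lt_one₀ (norm_nonneg _) (by simpa using hu) two_ne_zero)
  have hD : ∀ u ∈ ball (0 : ℂ) 1, 0 ≤ (1 - ‖Θ u‖ ^ 2) / (1 - ‖u‖ ^ 2) := fun u hu =>
    div_nonneg (sub_nonneg.2 (pow_le_one₀ (norm_nonneg _) (hΘ.norm_le_one hu))) (hpos u hu).le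
  have hmeas : AEMeasurable (fun u => ENNReal.ofReal
      ((1 - ‖u‖ ^ 2) ^ α * ((1 - ‖Θ u‖ ^ 2) / (1 - ‖u‖ ^ 2)) ^ p)) discArea := by
    refine AEMeasurable.smul_measure (AEMeasurable.ennreal_ofReal ?_) _
    refine ContinuousOn.aemeasurable ?_ measurableSet_ball
    refine ContinuousOn.mul ?_ ?_
    · exact ContinuousOn.rpow_const (by fun_prop) fun u hu => Or.inl (hpos u hu).ne'
    · refine ContinuousOn.rpow_const ?_ fun u hu => Or.inr hp0.le
      exact ContinuousOn.div (by fun_prop) (by fun_prop) fun u hu => (hpos u hu).ne'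
  have hle : ∫⁻ u, ENNReal.ofReal ((1 - ‖u‖ ^ 2) ^ α * ‖deriv f u‖ ^ p) ∂discArea ≤
      bmoaNorm f ^ p * dynkinIntegral p α Θ := by
    rw [dynkinIntegral, ← lintegral_const_mul'' _ hmeas]
    refine lintegral_mono_ae (Measure.ae_smul_measure ?_ _)
    filter_upwards [ae_restrict_mem measurableSet_ball] with u hu
    have hw : 0 ≤ (1 - ‖u‖ ^ 2) ^ α := Real.rpow_nonneg (hpos u hu).le _
    rw [ENNReal.ofReal_mul hw, ENNReal.ofReal_mul hw, mul_left_comm,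
      ← ENNReal.ofReal_rpow_of_nonneg (norm_nonneg _) hp0.le,
      ← ENNReal.ofReal_rpow_of_nonneg (hD u hu) hp0.le, ← ENNReal.mul_rpow_of_nonneg _ _ hp0.le]
    gcongr
    exact hf.ofReal_norm_deriv_le hΘ hu
  calc bergmanNorm p α (deriv f) ≤ (bmoaNorm f ^ p * dynkinIntegral p α Θ) ^ (1 / p) :=
        ENNReal.rpow_le_rpow hle (by positivity)
    _ = bmoaNorm f * dynkinIntegral p α Θ ^ (1 / p) := by
        rw [ENNReal.mul_rpow_of_nonneg _ _ (by positivity), ← ENNReal.rpow_mul,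
          mul_one_div_cancel hp0.ne', ENNReal.rpow_one]
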